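/- Let $R$ be a commutative Noetherian ring of finite Krull dimension. For a finitely generated $R$-module $N$, let its (ordinal) length $\operatorname{len}(N)$ be the supremum of all ordinals $\alpha$ for which there is a strictly descending chain $(N_i)_{i\le\alpha}$ of submodules of $N$. Let the finitistic length $\ell(N)$ be the supremum of the lengths of those submodules of $N$ whose length is $<\omega$. The fundamental cycle of $N$ is $\sum_{\mathfrak p}\ell(N_{\mathfrak p})[\mathfrak p]$, where $\mathfrak p$ runs over the prime ideals of $R$ and $\ell(N_{\mathfrak p})$ is taken over $R_{\mathfrak p}$. The module $N$ is called binary if its fundamental cycle is a sum of distinct primes, i.e. equals $\sum_{\mathfrak p\in S}[\mathfrak p]$ for some finite set $S$ of prime ideals. For an ordinal $\alpha<\omega^\omega$ with Cantor normal form $\alpha=\omega^d a_d+\dots+\omega a_1+a_0$, write $\alpha^+_e:=\omega^d a_d+\dots+\omega^{e+1}a_{e+1}$ for the part of order $>e$ and $\alpha^-_e:=\omega^e a_e+\dots+\omega a_1+a_0$ for the part of degree $\le e$. For an integer $e$, let $\mathfrak D_e(M)$ be the submodule of all $a\in M$ such that $\dim(Ra)\le e$, where $\dim 0=-\infty$ (so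 $\mathfrak D_{-1}(M)=0$). **Proposition.** Let $M$ be a finitely generated binary $R$-module of length $\mu$, let $e\ge 0$ be an integer with $e\le\dim M$, and let $v_e$ be the number of associated primes $\mathfrak p$ of $M$ with $\dim(R/\mathfrak p)=e$. Then $\mathfrak D_e(M)$, $M/\mathfrak D_e(M)$ and $\mathfrak D_e(M)/\mathfrak D_{e-1}(M)$ are binary modules, of length $\mu^-_e$, $\mu^+_e$ and $\omega^e\cdot v_e$ (the $v_e$-fold sum $\omega^e+\dots+\omega^e$), respectively. -/

import Mathlib

open scoped Ordinal

universe u v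

namespace OrdinalLength

/-- The ordinal length of a module: the supremum of all ordinals `α` for which there is a strictly
descending chain of submodules `(N_i)`, `i ≤ α`. As for finite chains `N_0 ⊋ ⋯ ⊋ N_n`, which have
length `n`, the length of such a chain is `α` (although it has order type `α + 1`). -/
noncomputable def ordLength (R : Type u) (M : Type v) [CommRing R] [AddCommGroup M] [Module R M] :
    Ordinal.{v} :=
  sSup {α : Ordinal.{v} | ∃ N : Set.Iic α → Submodule R M, StrictAnti N}

/-- The supremum in the definition of `ordLength` is taken over a bounded set. -/
theorem bddAbove_chainLengths (R : Type u) (M : Type v) [CommRing R] [AddCommGroup M]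
    [Module R M] :
    BddAbove {α : Ordinal.{v} | ∃ N : Set.Iic α → Submodule R M, StrictAnti N} := by
  refine ⟨(Order.succ (Cardinal.mk (Submodule R M))).ord, ?_⟩
  rintro α ⟨N, hN⟩
  by_contra h
  have h1 : (Order.succ (Cardinal.mk (Submodule R M))) ≤ α.card := by
    have := Ordinal.card_le_card (not_le.1 h).le
    simpa using this
  have h2 : Cardinal.lift.{v + 1} α.card ≤ Cardinal.lift.{v + 1} (Cardinal.mk (Submodule R M)) := by
    rw [← Cardinal.mk_Iio_ordinal]
    have hinj : Function.Injective
        (fun i : Set.Iio α => N ⟨i.1, Set.mem_Iic.2 (Set.mem_Iio.1 i.2).le⟩) := by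
      intro i j hij
      have := hN.injective hij
      exact Subtype.ext (congrArg (fun x : Set.Iic α => x.1) this)
    have := Cardinal.mk_le_of_injective
      (f := fun i : Set.Iio α => ULift.up.{v + 1}
        (N ⟨i.1, Set.mem_Iic.2 (Set.mem_Iio.1 i.2).le⟩))
      (fun i j hij => hinj (ULift.up.inj hij))
    simpa using this
  exact absurd (Order.lt_succ _) (not_lt.2 (h1.trans (Cardinal.lift_le.1 h2)))

/-- The finitistic length: the supremum of the lengths of the submodules whose length is less
than `ω`. -/
noncomputable def finitisticLength (R : Type u) (M : Type v) [CommRing R] [AddCommGroup M]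
    [Module R M] : Ordinal.{v} :=
  sSup {α : Ordinal.{v} | α < ω ∧ ∃ N : Submodule R M, ordLength R N = α}

/-- The fundamental cycle of a module, as the family of its coefficients: the coefficient at a
prime `p` is the finitistic length of `M_p` over `R_p`. -/
noncomputable def fundamentalCycle (R : Type u) (M : Type v) [CommRing R] [AddCommGroup M]
    [Module R M] (p : PrimeSpectrum R) : Ordinal.{max u v} :=
  finitisticLength (Localization.AtPrime p.asIdeal) (LocalizedModule p.asIdeal.primeCompl M)

open scoped Classical in
/-- A module is binary if its fundamental cycle is a sum of distinct primes, that is, the sum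
of the `[p]` for `p` in some finite set `S` of primes. -/
def IsBinary (R : Type u) (M : Type v) [CommRing R] [AddCommGroup M] [Module R M] : Prop :=
  ∃ S : Finset (PrimeSpectrum R), ∀ p : PrimeSpectrum R,
    fundamentalCycle R M p = if p ∈ S then 1 else 0

/-- The dimension of an element `a`, that is, of the submodule `R a`; it is `⊥` for `a = 0`. -/
noncomputable def elemDim (R : Type u) {M : Type v} [CommRing R] [AddCommGroup M] [Module R M]
    (a : M) : WithBot ℕ∞ :=
  Module.supportDim R (Submodule.span R {a})

theorem elemDim_smul_le {R : Type u} {M : Type v} [CommRing R] [AddCommGroup M] [Module R M]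
    (r : R) (a : M) : elemDim R (r • a) ≤ elemDim R a :=
  Module.supportDim_le_of_injective
    (Submodule.inclusion (Submodule.span_singleton_smul_le R r a))
    (Submodule.inclusion_injective _)

theorem mem_support_span_singleton {R : Type u} {M : Type v} [CommRing R] [AddCommGroup M]
    [Module R M] (a : M) (p : PrimeSpectrum R) :
    p ∈ Module.support R (Submodule.span R {a}) ↔ ∀ r ∉ p.asIdeal, r • a ≠ 0 := by
  rw [Module.mem_support_iff']
  constructor
  · rintro ⟨⟨m, hm⟩, h⟩ r hr hra
    obtain ⟨c, rfl⟩ := Submodule.mem_span_singleton.1 hm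
    refine h r hr (Subtype.ext ?_)
    change r • c • a = 0
    rw [smul_comm, hra, smul_zero]
  · intro h
    exact ⟨⟨a, Submodule.mem_span_singleton_self a⟩,
      fun r hr hra => h r hr (congrArg Subtype.val hra)⟩

theorem elemDim_add_le {R : Type u} {M : Type v} [CommRing R] [AddCommGroup M] [Module R M]
    (a b : M) : elemDim R (a + b) ≤ max (elemDim R a) (elemDim R b) := by
  have key : ∀ (c : M) (s : LTSeries (Module.support R (Submodule.span R {a + b}))),
      s.head.1 ∈ Module.support R (Submodule.span R {c}) →
      (s.length : WithBot ℕ∞) ≤ elemDim R c := by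
    intro c s hs
    let t : LTSeries (Module.support R (Submodule.span R {c})) :=
      { length := s.length
        toFun := fun i => ⟨(s i).1, Module.mem_support_mono (s.head_le i) hs⟩
        step := fun i => s.step i }
    exact Order.LTSeries.length_le_krullDim t
  refine iSup_le fun s => ?_
  by_cases ha : s.head.1 ∈ Module.support R (Submodule.span R {a})
  · exact (key a s ha).trans (le_max_left _ _)
  by_cases hb : s.head.1 ∈ Module.support R (Submodule.span R {b})
  · exact (key b s hb).trans (le_max_right _ _)
  exfalso
  have hab := (mem_support_span_singleton _ _).1 s.head.2
  rw [mem_support_span_singleton] at ha hb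
  push Not at ha hb
  obtain ⟨r, hr, hra⟩ := ha
  obtain ⟨t, ht, htb⟩ := hb
  refine hab (r * t) (fun h => (s.head.1.isPrime.mem_or_mem h).elim hr ht) ?_
  rw [smul_add, mul_smul r t b, htb, smul_zero, mul_comm, mul_smul, hra, smul_zero, add_zero]

/-- The dimension filtration: `D_e(M)` is the submodule of all elements of dimension at most `e`.
The index is an integer, so that `D_{-1}(M)` makes sense; it consists of `0`, the only element of
dimension `-∞`. -/
def dimFiltration (R : Type u) (M : Type v) [CommRing R] [AddCommGroup M] [Module R M] (e : ℤ) :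
    Submodule R M where
  carrier := {a | a = 0 ∨ ∃ n : ℕ, (n : ℤ) ≤ e ∧ elemDim R a ≤ (n : WithBot ℕ∞)}
  zero_mem' := Or.inl rfl
  add_mem' := by
    rintro a b (rfl | ⟨m, hm, ha⟩) (rfl | ⟨n, hn, hb⟩)
    · exact Or.inl (add_zero 0)
    · exact Or.inr ⟨n, hn, by rwa [zero_add]⟩
    · exact Or.inr ⟨m, hm, by rwa [add_zero]⟩
    · rcases le_total m n with h | h
      · refine Or.inr ⟨n, hn, (elemDim_add_le a b).trans (max_le (ha.trans ?_) hb)⟩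
        exact_mod_cast h
      · refine Or.inr ⟨m, hm, (elemDim_add_le a b).trans (max_le ha (hb.trans ?_))⟩
        exact_mod_cast h
  smul_mem' := by
    rintro r a (rfl | ⟨n, hn, ha⟩)
    · exact Or.inl (smul_zero r)
    · exact Or.inr ⟨n, hn, (elemDim_smul_le r a).trans ha⟩

/-- The number of associated primes of `M` of dimension `e`. -/
noncomputable def numAssPrimes (R : Type u) (M : Type v) [CommRing R] [AddCommGroup M]
    [Module R M] (e : ℕ) : ℕ :=
  {p : Ideal R | p ∈ associatedPrimes R M ∧ ringKrullDim (R ⧸ p) = (e : WithBot ℕ∞)}.ncard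

/-- The part `∑_{i > e} a_i ω^i` of an ordinal with Cantor normal form `∑_i a_i ω^i`. -/
noncomputable def upperPart (α : Ordinal.{v}) (e : ℕ) : Ordinal.{v} :=
  Ordinal.CNF.eval ω ((Ordinal.CNF.coeff ω α).filter fun i => (e : Ordinal.{v}) < i)

/-- The part `∑_{i ≤ e} a_i ω^i` of an ordinal with Cantor normal form `∑_i a_i ω^i`. -/
noncomputable def lowerPart (α : Ordinal.{v}) (e : ℕ) : Ordinal.{v} :=
  Ordinal.CNF.eval ω ((Ordinal.CNF.coeff ω α).filter fun i => i ≤ (e : Ordinal.{v}))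

end OrdinalLength

/-! Everything follows from one formula (`IsBinary.ordLength_eq`): a binary module has length `∑ ω ^
dim (R ⧸ p)` over its associated primes, in decreasing order.

Lower bound: `R ⧸ p` has a chain of length `ω ^ dim (R ⧸ p)`, obtained by iterating multiplication
by an element of a larger prime (`hasChain_quotient_prime`). Copies of such quotients are split off
`M` one at a time, smallest dimension first (`hasChain_of_subset_associatedPrimes`).

Upper bound: ordering the multiplicities lexicographically by dimension attaches to `M ⧸ N` an
ordinal that drops strictly as `N` grows (`lexSum_dimRank_lt`). Along a descending chain it
therefore increases strictly, which bounds the length.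

The associated primes of `D_e(M)` are those of `M` of dimension at most `e`, and those of `M ⧸
D_e(M)` are the others. Multiplicities do not grow, so both modules are again binary, and the
formula yields the truncations of the Cantor normal form. -/

namespace OrdinalLength

/-! ### Transfinite chains of submodules -/

section Chains

/-- A strictly descending chain of ordinal length `α` in a preorder. -/
def HasChain (X : Type*) [Preorder X] (α : Ordinal.{v}) : Prop :=
  ∃ N : Ordinal.{v} → X, StrictAntiOn N (Set.Iic α)

theorem HasChain.map {X Y : Type*} [Preorder X] [Preorder Y] {α : Ordinal.{v}}
    (h : HasChain X α) {f : X → Y} (hf : StrictMono f) : HasChain Y α := by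
  obtain ⟨N, hN⟩ := h
  exact ⟨f ∘ N, hf.comp_strictAntiOn hN⟩

theorem HasChain.of_le {X : Type*} [Preorder X] {α β : Ordinal.{v}}
    (h : HasChain X β) (hle : α ≤ β) : HasChain X α := by
  obtain ⟨N, hN⟩ := h
  exact ⟨N, hN.mono (Set.Iic_subset_Iic.2 hle)⟩

theorem hasChain_zero (X : Type*) [Preorder X] [Nonempty X] : HasChain X (0 : Ordinal.{v}) := by
  refine ⟨fun _ => Classical.arbitrary X, fun i hi j hj hij => ?_⟩
  have hj' : j ≤ 0 := hj
  exact absurd (hij.trans_le hj') (not_lt.2 zero_le)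

theorem hasChain_iff {X : Type*} [Preorder X] {α : Ordinal.{v}} :
    HasChain X α ↔ ∃ N : Set.Iic α → X, StrictAnti N := by
  constructor
  · rintro ⟨N, hN⟩
    exact ⟨fun i => N i, fun i j hij => hN i.2 j.2 hij⟩
  · rintro ⟨N, hN⟩
    refine ⟨fun i => N ⟨min i α, Set.mem_Iic.2 (min_le_right _ _)⟩, fun i hi j hj hij => hN ?_⟩
    have hi' : i ≤ α := hi
    have hj' : j ≤ α := hj
    simpa [Subtype.mk_lt_mk, hi', hj'] using hij

variable {R : Type u} {M : Type v} [CommRing R] [AddCommGroup M] [Module R M]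

theorem HasChain.le_ordLength {α : Ordinal.{v}} (h : HasChain (Submodule R M) α) :
    α ≤ ordLength R M :=
  le_csSup (bddAbove_chainLengths R M) (hasChain_iff.1 h)

theorem ordLength_le {a : Ordinal.{v}}
    (h : ∀ α : Ordinal.{v}, HasChain (Submodule R M) α → α ≤ a) : ordLength R M ≤ a :=
  csSup_le ⟨0, hasChain_iff.1 (hasChain_zero _)⟩ fun α hα => h α (hasChain_iff.2 hα)

theorem HasChain.exists_of_lt_ordLength {β : Ordinal.{v}} (h : β < ordLength R M) :
    ∃ α, β < α ∧ HasChain (Submodule R M) α := by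
  by_contra! H
  exact (ordLength_le fun α hα => not_lt.1 fun hlt => H α hlt hα).not_gt h

/-- Chains in a submodule and in the quotient by it can be concatenated. -/
theorem HasChain.add {R M : Type*} [CommRing R] [AddCommGroup M] [Module R M]
    {N : Submodule R M} {α β : Ordinal.{v}} (hQ : HasChain (Submodule R (M ⧸ N)) α)
    (hN : HasChain (Submodule R N) β) : HasChain (Submodule R M) (α + β) := by
  classical
  obtain ⟨A, hA⟩ := hQ
  obtain ⟨B, hB⟩ := hN
  -- The chain of the quotient comes first. `B 0` is skipped: index `α` belongs to `A`, whose
  -- preimages contain `N ≥ B 0`.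
  refine ⟨fun i => if i ≤ α then (A i).comap N.mkQ else (B (i - α)).map N.subtype, ?_⟩
  have hsub : ∀ {j}, α < j → j ≤ α + β → j - α ≤ β := fun _ h => Ordinal.sub_le.2 h
  have hpos : ∀ {j}, α < j → 0 < j - α := fun h => by
    rw [Ordinal.lt_sub, add_zero]; exact h
  intro i hi j hj hij
  by_cases hjα : j ≤ α
  · have hiα := hij.le.trans hjα
    simp only [hjα, hiα, if_true]
    exact (Submodule.comap_strictMono_of_surjective N.mkQ_surjective) (hA hiα hjα hij)
  · have hj' := not_le.1 hjα
    simp only [hjα, if_false]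
    by_cases hiα : i ≤ α
    · simp only [hiα, if_true]
      refine lt_of_lt_of_le (b := N) ?_ ?_
      · calc (B (j - α)).map N.subtype < (B 0).map N.subtype :=
              (Submodule.map_strictMono_of_injective N.injective_subtype)
                (hB (zero_le (a := β)) (hsub hj' hj) (hpos hj'))
          _ ≤ N := Submodule.map_subtype_le _ _
      · exact (Submodule.ker_mkQ N).symm.le.trans (LinearMap.ker_le_comap _)
    · have hi' := not_le.1 hiα
      simp only [hiα, if_false]
      refine (Submodule.map_strictMono_of_injective N.injective_subtype)
        (hB (hsub hi' hi) (hsub hj' hj) ?_)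
      rw [Ordinal.lt_sub, Ordinal.add_sub_cancel_of_le hi'.le]
      exact hij

/-- If `l` is an injective endomorphism, then the images under the powers of `l` of a chain of
submodules containing the range of `l` can be concatenated. -/
theorem HasChain.mul_omega0 {R M : Type*} [CommRing R] [AddCommGroup M] [Module R M]
    {l : M →ₗ[R] M} (hl : Function.Injective l) {β : Ordinal.{v}} (hβ : 0 < β)
    {C : Ordinal.{v} → Submodule R M} (hC : StrictAntiOn C (Set.Iic β))
    (hlC : LinearMap.range l ≤ C β) : HasChain (Submodule R M) (β * ω) := by
  classical
  have hinj : ∀ n : ℕ, Function.Injective (l ^ n) := fun n => by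
    rw [Module.End.coe_pow]; exact hl.iterate n
  have hmap : ∀ n : ℕ, StrictMono (Submodule.map (l ^ n)) := fun n =>
    Submodule.map_strictMono_of_injective (hinj n)
  -- For `i < β * ω` the quotient `i / β` is finite; it counts how often `l` is applied, while `i %
  -- β` gives the place within the block.
  let ν : Ordinal.{v} → ℕ := fun i => Cardinal.toNat (i / β).card
  have hν : ∀ i < β * ω, ((ν i : ℕ) : Ordinal.{v}) = i / β := by
    intro i hi
    have : i / β < ω := (Ordinal.lt_mul_iff_div_lt hβ.ne').1 hi
    obtain ⟨n, hn⟩ := Ordinal.lt_omega0.1 this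
    simp [ν, hn]
  have hmod : ∀ i, i % β < β := fun i => Ordinal.mod_lt i hβ.ne'
  let D : Ordinal.{v} → Submodule R M := fun i => (C (i % β)).map (l ^ ν i)
  -- `C β` is not itself a term of a block: its image separates the block from all later ones, which
  -- lie in the image of `range l ≤ C β`.
  have hD : ∀ i, (C β).map (l ^ ν i) < D i := fun i =>
    hmap _ (hC (hmod i).le Set.self_mem_Iic (hmod i))
  refine ⟨fun i => if i < β * ω then D i else ⊥, ?_⟩
  intro i hi j hj hij
  have hi' : i < β * ω := hij.trans_le hj
  by_cases hj' : j < β * ω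
  · simp only [hi', hj', if_true]
    have hle : i / β ≤ j / β := Ordinal.div_le_left hij.le β
    rcases hle.eq_or_lt with heq | hlt
    · have hνeq : ν i = ν j := by simp only [ν, heq]
      simp only [D, hνeq]
      refine hmap _ (hC (hmod i).le (hmod j).le ?_)
      have h1 := Ordinal.div_add_mod i β
      have h2 := Ordinal.div_add_mod j β
      rw [← h1, ← h2, heq] at hij
      exact lt_of_add_lt_add_left hij
    · rw [← hν i hi', ← hν j hj', Nat.cast_lt] at hlt
      refine lt_of_le_of_lt ?_ (hD i)
      obtain ⟨k, hk⟩ := Nat.exists_eq_add_of_lt hlt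
      have hpow : l ^ ν j = l ^ ν i * (l * l ^ k) := by
        rw [hk, ← pow_succ', ← pow_add, add_assoc]
      simp only [D, hpow, Module.End.mul_eq_comp, Submodule.map_comp]
      exact Submodule.map_mono ((LinearMap.map_le_range).trans hlC)
  · simp only [hi', hj', if_true, if_false]
    exact lt_of_le_of_lt bot_le (hD i)

/-- If `p` is a prime with `dim (R ⧸ p) ≥ e`, then `R ⧸ p` has length at least `ω ^ e`. -/
theorem hasChain_quotient_prime {R : Type*} [CommRing R] (e : ℕ) (p : PrimeSpectrum R)
    (he : (e : ℕ∞) ≤ Order.coheight p) :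
    HasChain (Submodule R (R ⧸ p.asIdeal)) (ω ^ (e : Ordinal.{v})) := by
  induction e generalizing p with
  | zero =>
    have := Ideal.Quotient.nontrivial_iff.2 p.isPrime.ne_top
    refine ⟨fun i => if i = 0 then ⊤ else ⊥, fun i hi j hj hij => ?_⟩
    have hj1 : j ≤ 1 := by simpa using hj
    have hi0 : i = 0 := Order.lt_one_iff.1 (hij.trans_le hj1)
    simp [hi0, (hi0 ▸ hij).ne', bot_lt_top]
  | succ e ih =>
    obtain ⟨q, hpq, hq⟩ : ∃ q, p < q ∧ (e : ℕ∞) ≤ Order.coheight q := by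
      by_contra! H
      have := Order.coheight_le_coe_iff.2 fun y hy => H y hy
      have := he.trans this
      norm_cast at this
      omega
    obtain ⟨C, hC⟩ := ih q hq
    -- Multiplication by `x` is injective on the domain `R ⧸ p`, and its range lies in `q ⧸ p`, the
    -- kernel of `φ`, hence in every preimage under `φ`.
    obtain ⟨x, hxq, hxp⟩ := Set.exists_of_ssubset hpq
    have hpq' : p.asIdeal ≤ q.asIdeal := hpq.le
    let φ : (R ⧸ p.asIdeal) →ₗ[R] (R ⧸ q.asIdeal) := Submodule.factor hpq'
    have hφ : Function.Surjective φ := Submodule.factor_surjective hpq'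
    have hl : Function.Injective (LinearMap.lsmul R (R ⧸ p.asIdeal) x) := by
      rw [injective_iff_map_eq_zero]
      intro a ha
      obtain ⟨r, rfl⟩ := Ideal.Quotient.mk_surjective a
      have : Ideal.Quotient.mk p.asIdeal (x * r) = 0 := ha
      rw [Ideal.Quotient.eq_zero_iff_mem] at this ⊢
      exact (p.isPrime.mem_or_mem this).resolve_left hxp
    have := HasChain.mul_omega0 hl (Ordinal.opow_pos (e : Ordinal.{v}) Ordinal.omega0_pos)
      (C := fun i => (C i).comap φ)
      ((Submodule.comap_strictMono_of_surjective hφ).comp_strictAntiOn hC) (by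
        rintro _ ⟨a, rfl⟩
        obtain ⟨r, rfl⟩ := Ideal.Quotient.mk_surjective a
        have h0 : φ (LinearMap.lsmul R (R ⧸ p.asIdeal) x (Ideal.Quotient.mk _ r)) = 0 :=
          Ideal.Quotient.eq_zero_iff_mem.2 (q.asIdeal.mul_mem_right r hxq)
        rw [Submodule.mem_comap, h0]
        exact zero_mem _)
    simpa [Ordinal.opow_succ] using this

end Chains

/-! ### Ordinals below `ω ^ ω` as lexicographic sums -/

section LexSum

/-- The ordinal `ω ^ (D - 1) * f (D - 1) + ⋯ + ω * f 1 + f 0`. -/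
noncomputable def lexSum (f : ℕ → ℕ) : ℕ → Ordinal.{v}
  | 0 => 0
  | d + 1 => ω ^ (d : Ordinal.{v}) * (f d : Ordinal.{v}) + lexSum f d

theorem lexSum_lt (f : ℕ → ℕ) (D : ℕ) : lexSum f D < ω ^ (D : Ordinal.{v}) := by
  induction D with
  | zero => simp [lexSum]
  | succ d ih =>
    rw [lexSum]
    exact Ordinal.opow_mul_add_lt_opow (Ordinal.natCast_lt_omega0 _) ih
      (by exact_mod_cast d.lt_succ_self)

theorem lexSum_congr {f g : ℕ → ℕ} {D : ℕ} (h : ∀ d < D, f d = g d) :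
    lexSum.{v} f D = lexSum g D := by
  induction D with
  | zero => rfl
  | succ d ih =>
    rw [lexSum, lexSum, h d d.lt_succ_self, ih fun i hi => h i (hi.trans d.lt_succ_self)]

theorem lexSum_eq_zero {f : ℕ → ℕ} {D : ℕ} (h : ∀ d < D, f d = 0) : lexSum.{v} f D = 0 := by
  induction D with
  | zero => rfl
  | succ d ih => simp [lexSum, h d d.lt_succ_self, ih fun i hi => h i (hi.trans d.lt_succ_self)]

/-- `lexSum` is strictly monotone for the lexicographic order. -/
theorem lexSum_lt_lexSum {f g : ℕ → ℕ} {d D : ℕ} (hd : d < D) (hlt : f d < g d)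
    (hle : ∀ i, d < i → f i ≤ g i) : lexSum.{v} f D < lexSum g D := by
  induction D with
  | zero => omega
  | succ k ih =>
    rw [lexSum, lexSum]
    rcases (Nat.lt_succ_iff.1 hd).eq_or_lt with rfl | hdk
    · calc ω ^ (d : Ordinal.{v}) * (f d : Ordinal.{v}) + lexSum f d
          < ω ^ (d : Ordinal.{v}) * (f d : Ordinal.{v}) + ω ^ (d : Ordinal.{v}) :=
            add_lt_add_right (lexSum_lt f d) _
        _ = ω ^ (d : Ordinal.{v}) * ((f d + 1 : ℕ) : Ordinal.{v}) := by
            rw [Nat.cast_succ, mul_add_one]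
        _ ≤ ω ^ (d : Ordinal.{v}) * (g d : Ordinal.{v}) := by
            gcongr
            exact hlt
        _ ≤ _ := le_self_add
    · calc ω ^ (k : Ordinal.{v}) * (f k : Ordinal.{v}) + lexSum f k
          < ω ^ (k : Ordinal.{v}) * (f k : Ordinal.{v}) + lexSum g k :=
            add_lt_add_right (ih hdk) _
        _ ≤ _ := by
            gcongr
            exact hle k hdk

/-- Adding `ω ^ e` on the right would absorb all terms of lower exponent; since `f` vanishes below
`e`, nothing is lost. -/
theorem lexSum_add_opow {f g : ℕ → ℕ} {e D : ℕ} (heD : e < D) (hf : ∀ i < e, f i = 0)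
    (hge : g e = f e + 1) (hg : ∀ i, i ≠ e → g i = f i) :
    lexSum.{v} g D = lexSum f D + ω ^ (e : Ordinal.{v}) := by
  induction D with
  | zero => omega
  | succ k ih =>
    rw [lexSum, lexSum]
    rcases (Nat.lt_succ_iff.1 heD).eq_or_lt with rfl | hek
    · rw [lexSum_eq_zero hf, lexSum_eq_zero fun i hi => (hg i hi.ne).trans (hf i hi), hge,
        Nat.cast_succ, mul_add_one, add_zero, add_zero]
    · rw [ih hek, hg k hek.ne', add_assoc]

theorem lexSum_single {f : ℕ → ℕ} {e D : ℕ} (heD : e < D) (hf : ∀ i, i ≠ e → f i = 0) :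
    lexSum.{v} f D = ω ^ (e : Ordinal.{v}) * (f e : Ordinal.{v}) := by
  induction D with
  | zero => omega
  | succ k ih =>
    rw [lexSum]
    rcases (Nat.lt_succ_iff.1 heD).eq_or_lt with rfl | hek
    · rw [lexSum_eq_zero fun i hi => hf i hi.ne, add_zero]
    · rw [ih hek, hf k hek.ne', Nat.cast_zero, mul_zero, zero_add]

/-- With finite coefficients and decreasing exponents, `lexSum f D` is already a Cantor normal form
up to zero terms. -/
theorem eval_filter_coeff_lexSum (P : Ordinal.{v} → Prop) [DecidablePred P] (f : ℕ → ℕ) (D : ℕ) :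
    Ordinal.CNF.eval ω ((Ordinal.CNF.coeff ω (lexSum.{v} f D)).filter P) =
      lexSum (fun d => if P d then f d else 0) D := by
  induction D with
  | zero =>
    simp [lexSum, show Finsupp.filter P (0 : Ordinal.{v} →₀ Ordinal.{v}) = 0 from Finsupp.filter_zero P]
  | succ d ih =>
    rw [lexSum, lexSum, ← ih]
    rcases eq_or_ne (f d) 0 with h0 | h0
    · simp [h0]
    rw [Ordinal.CNF.coeff_opow_mul_add Ordinal.one_lt_omega0 (by exact_mod_cast h0)
      (Ordinal.natCast_lt_omega0 _) (lexSum_lt f d), Finsupp.filter_add]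
    by_cases hP : P d
    · rw [Finsupp.filter_single_of_pos _ hP, if_pos hP, Ordinal.CNF.eval_single_add']
      intro e' he'
      rw [Finsupp.support_filter, Finset.mem_filter, Finsupp.mem_support_iff] at he'
      by_contra hle
      refine he'.1 (Ordinal.CNF.coeff_eq_zero_of_lt ((lexSum_lt f d).trans_le ?_))
      exact Ordinal.opow_le_opow_right Ordinal.omega0_pos (not_lt.1 hle)
    · rw [Finsupp.filter_single_of_neg _ hP, if_neg hP]
      simp

theorem upperPart_lexSum (f : ℕ → ℕ) (D e : ℕ) :
    upperPart (lexSum.{v} f D) e = lexSum (fun d => if e < d then f d else 0) D := by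
  rw [upperPart, eval_filter_coeff_lexSum]
  simp

theorem lowerPart_lexSum (f : ℕ → ℕ) (D e : ℕ) :
    lowerPart (lexSum.{v} f D) e = lexSum (fun d => if d ≤ e then f d else 0) D := by
  rw [lowerPart, eval_filter_coeff_lexSum]
  simp

end LexSum

/-! ### Finite lengths and finitistic length -/

section FiniteLength

theorem natCast_le_length_iff {R M : Type*} [CommRing R] [AddCommGroup M] [Module R M] {n : ℕ} :
    (n : ℕ∞) ≤ Module.length R M ↔ ∃ s : LTSeries (Submodule R M), s.length = n := by
  rw [← Order.le_krullDim_iff, ← Module.coe_length]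
  norm_cast

theorem natCast_le_ordLength_iff {R : Type u} {M : Type v} [CommRing R] [AddCommGroup M]
    [Module R M] {n : ℕ} :
    (n : Ordinal.{v}) ≤ ordLength R M ↔ (n : ℕ∞) ≤ Module.length R M := by
  rw [natCast_le_length_iff]
  constructor
  · intro h
    obtain ⟨N, hN⟩ : HasChain (Submodule R M) (n : Ordinal.{v}) := by
      cases n with
      | zero => simpa using hasChain_zero _
      | succ m =>
        -- The supremum need not be attained a priori, but some chain is longer than `m`, and it can
        -- be truncated to length `m + 1`.
        obtain ⟨α, hα, hc⟩ := HasChain.exists_of_lt_ordLength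
          (lt_of_lt_of_le (by exact_mod_cast m.lt_succ_self) h : (m : Ordinal.{v}) < ordLength R M)
        refine hc.of_le ?_
        rw [Nat.cast_succ]
        exact Order.add_one_le_of_lt hα
    refine ⟨LTSeries.mk n (fun i => N ((n - i : ℕ) : Ordinal.{v})) fun i j hij => ?_, rfl⟩
    refine hN ?_ ?_ ?_
    · exact Set.mem_Iic.2 (by exact_mod_cast Nat.sub_le _ _)
    · exact Set.mem_Iic.2 (by exact_mod_cast Nat.sub_le _ _)
    · have hj := j.is_lt
      have : (i : ℕ) < j := hij
      exact_mod_cast (by omega : n - (j : ℕ) < n - (i : ℕ))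
  · rintro ⟨s, rfl⟩
    refine HasChain.le_ordLength ⟨fun α => s ⟨s.length - Cardinal.toNat α.card, by omega⟩, ?_⟩
    intro i hi j hj hij
    obtain ⟨b, rfl⟩ := Ordinal.lt_omega0.1 ((Set.mem_Iic.1 hj).trans_lt (Ordinal.natCast_lt_omega0 _))
    obtain ⟨a, rfl⟩ := Ordinal.lt_omega0.1 (hij.trans (Ordinal.natCast_lt_omega0 _))
    refine s.strictMono ?_
    have hb : b ≤ s.length := by exact_mod_cast Set.mem_Iic.1 hj
    have hab : a < b := by exact_mod_cast hij
    simp only [Ordinal.card_nat, Cardinal.toNat_natCast, Fin.mk_lt_mk]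
    omega

theorem ordLength_lt_omega0_iff {R : Type u} {M : Type v} [CommRing R] [AddCommGroup M]
    [Module R M] : ordLength R M < ω ↔ Module.length R M ≠ ⊤ := by
  constructor
  · intro h htop
    obtain ⟨n, hn⟩ := Ordinal.lt_omega0.1 h
    have := (natCast_le_ordLength_iff (R := R) (M := M) (n := n + 1)).2 (by simp [htop])
    rw [hn] at this
    norm_cast at this
    omega
  · intro h
    obtain ⟨n, hn⟩ := ENat.ne_top_iff_exists.1 h
    by_contra hlt
    have := (natCast_le_ordLength_iff (R := R) (M := M) (n := n + 1)).1
      ((Ordinal.natCast_lt_omega0 _).le.trans (not_lt.1 hlt))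
    rw [← hn] at this
    norm_cast at this
    omega

/-- The supremum of the finite lengths of submodules of `B`. -/
noncomputable def finLength (S B : Type*) [CommRing S] [AddCommGroup B] [Module S B] : ℕ∞ :=
  ⨆ K : {K : Submodule S B // Module.length S K ≠ ⊤}, Module.length S K.1

section

variable {S A B C : Type*} [CommRing S] [AddCommGroup A] [Module S A] [AddCommGroup B] [Module S B]
  [AddCommGroup C] [Module S C]

theorem length_le_finLength {K : Submodule S B} (hK : Module.length S K ≠ ⊤) :
    Module.length S K ≤ finLength S B :=
  le_iSup (fun K : {K : Submodule S B // Module.length S K ≠ ⊤} => Module.length S K.1) ⟨K, hK⟩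

theorem finLength_le {n : ℕ∞}
    (h : ∀ K : Submodule S B, Module.length S K ≠ ⊤ → Module.length S K ≤ n) :
    finLength S B ≤ n :=
  iSup_le fun K => h K.1 K.2

theorem finLength_le_of_injective {f : A →ₗ[S] B} (hf : Function.Injective f) :
    finLength S A ≤ finLength S B := by
  refine finLength_le fun K hK => ?_
  have e := (Submodule.equivMapOfInjective f hf K).length_eq
  rw [e] at hK ⊢
  exact length_le_finLength hK

/-- The preimage of a finite-length submodule of `C` is an extension of it by `A`, so it has finite
length if `A` does. Finiteness is essential: a discrete valuation ring has `finLength` zero, its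
residue field has one. -/
theorem finLength_add_length_le {f : A →ₗ[S] B} {g : B →ₗ[S] C} (hf : Function.Injective f)
    (hfg : Function.Exact f g) (hg : Function.Surjective g) (hA : Module.length S A ≠ ⊤) :
    finLength S C + Module.length S A ≤ finLength S B := by
  have : Nonempty {K : Submodule S C // Module.length S K ≠ ⊤} := ⟨⟨⊥, by simp⟩⟩
  rw [finLength, ENat.iSup_add]
  refine iSup_le fun ⟨K, hK⟩ => ?_
  let f' : A →ₗ[S] K.comap g := f.codRestrict _ fun a => by
    simp [hfg.apply_apply_eq_zero]
  let g' : K.comap g →ₗ[S] K := g.restrict fun _ h => h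
  have hlen : Module.length S (K.comap g) = Module.length S A + Module.length S K := by
    refine Module.length_eq_add_of_exact f' g' (fun a b h => hf (congrArg Subtype.val h)) ?_ ?_
    · rintro ⟨c, hc⟩
      obtain ⟨b, rfl⟩ := hg c
      exact ⟨⟨b, hc⟩, rfl⟩
    · rintro ⟨b, hb⟩
      constructor
      · intro h
        obtain ⟨a, ha⟩ := (hfg b).1 (congrArg Subtype.val h)
        exact ⟨a, Subtype.ext ha⟩
      · rintro ⟨a, ha⟩
        refine Subtype.ext ((hfg b).2 ⟨a, congrArg Subtype.val ha⟩)
  rw [add_comm, ← hlen]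
  refine length_le_finLength ?_
  rw [hlen]
  exact WithTop.add_ne_top.2 ⟨hA, hK⟩

/-- A maximal Artinian submodule contains every other one, because a sum of two Artinian submodules
is Artinian; being also Noetherian, it has finite length. -/
theorem finLength_ne_top [IsNoetherian S B] : finLength S B ≠ ⊤ := by
  obtain ⟨K, hK, hmax⟩ := WellFounded.has_min
    (wellFounded_gt : WellFounded ((· > ·) : Submodule S B → Submodule S B → Prop))
    {K | IsArtinian S K} ⟨⊥, (inferInstance : IsArtinian S (⊥ : Submodule S B))⟩
  have hK' : IsArtinian S K := hK
  refine ne_top_of_le_ne_top (Module.length_ne_top (R := S) (M := K)) (finLength_le fun L hL => ?_)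
  have hL' : IsArtinian S L :=
    (isFiniteLength_iff_isNoetherian_isArtinian.1 (Module.length_ne_top_iff.1 hL)).2
  have hle : L ≤ K := by
    have hsup : IsArtinian S (K ⊔ L : Submodule S B) := inferInstance
    have := eq_of_le_of_not_lt (le_sup_left : K ≤ K ⊔ L) (hmax _ hsup)
    rw [this]
    exact le_sup_right
  exact Module.length_le_of_injective (Submodule.inclusion hle) (Submodule.inclusion_injective hle)

/-- A nonzero submodule of finite length contains a simple one, which over a local ring is a copy of
the residue field. -/
theorem finLength_ne_zero_iff [IsLocalRing S] [IsNoetherianRing S] :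
    finLength S B ≠ 0 ↔ IsLocalRing.maximalIdeal S ∈ associatedPrimes S B := by
  rw [AssociatedPrimes.mem_iff, isAssociatedPrime_iff_exists_injective_linearMap]
  constructor
  · intro h
    obtain ⟨K, hK, h0⟩ : ∃ K : Submodule S B, Module.length S K ≠ ⊤ ∧ Module.length S K ≠ 0 := by
      by_contra! H
      exact h (le_zero_iff.1 (finLength_le fun K hK => (H K hK).le))
    obtain ⟨hN, hA⟩ := isFiniteLength_iff_isNoetherian_isArtinian.1 (Module.length_ne_top_iff.1 hK)
    rw [Ne, Module.length_eq_zero_iff, not_subsingleton_iff_nontrivial] at h0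
    obtain ⟨T, hT⟩ := IsAtomic.exists_atom (Submodule S K)
    have := isSimpleModule_iff_isAtom.2 hT
    obtain ⟨I, hI, ⟨e⟩⟩ := isSimpleModule_iff_quot_maximal.1 this
    obtain rfl := IsLocalRing.eq_maximalIdeal hI
    exact ⟨inferInstance, K.subtype ∘ₗ T.subtype ∘ₗ e.symm.toLinearMap,
      K.injective_subtype.comp (T.injective_subtype.comp e.symm.injective)⟩
  · rintro ⟨-, f, hf⟩
    have hs : IsSimpleModule S (S ⧸ IsLocalRing.maximalIdeal S) :=
      isSimpleModule_iff_quot_maximal.2 ⟨_, inferInstance, ⟨LinearEquiv.refl _ _⟩⟩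
    have hlen : Module.length S (LinearMap.range f) = 1 := by
      rw [← (LinearEquiv.ofInjective f hf).length_eq, Module.length_eq_one]
    have := length_le_finLength (S := S) (K := LinearMap.range f) (by simp [hlen])
    rw [hlen] at this
    intro h0
    simp [h0] at this

end

/-- Comparing the two notions at the values 1 and 0 is enough to detect binary modules. -/
theorem finLength_le_one_iff {S : Type u} {B : Type v} [CommRing S] [AddCommGroup B] [Module S B] :
    finLength S B ≤ 1 ↔ finitisticLength S B ≤ 1 := by
  have hbdd : BddAbove {α : Ordinal.{v} | α < ω ∧ ∃ N : Submodule S B, ordLength S N = α} :=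
    ⟨ω, fun α h => h.1.le⟩
  have key : ∀ K : Submodule S B, Module.length S K ≤ 1 ↔ ordLength S K ≤ 1 := fun K => by
    rw [← not_iff_not, not_le, not_le]
    have := natCast_le_ordLength_iff (R := S) (M := K) (n := 2)
    rw [← ENat.add_one_le_iff (by simp), ← Order.add_one_le_iff]
    rw [one_add_one_eq_two, one_add_one_eq_two]
    exact_mod_cast this.symm
  constructor
  · intro h
    refine csSup_le' ?_
    rintro _ ⟨hlt, K, rfl⟩
    rw [← key]
    exact (length_le_finLength (ordLength_lt_omega0_iff.1 hlt)).trans h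
  · intro h
    refine finLength_le fun K hK => (key K).2 (le_trans ?_ h)
    exact le_csSup hbdd ⟨ordLength_lt_omega0_iff.2 hK, K, rfl⟩

theorem finLength_eq_zero_iff {S : Type u} {B : Type v} [CommRing S] [AddCommGroup B]
    [Module S B] : finLength S B = 0 ↔ finitisticLength S B = 0 := by
  have hbdd : BddAbove {α : Ordinal.{v} | α < ω ∧ ∃ N : Submodule S B, ordLength S N = α} :=
    ⟨ω, fun α h => h.1.le⟩
  have key : ∀ K : Submodule S B, Module.length S K = 0 ↔ ordLength S K = 0 := fun K => by
    rw [← not_iff_not, ← Ne, ← Ne, ← Order.one_le_iff_ne_zero, ← Order.one_le_iff_ne_zero]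
    have := natCast_le_ordLength_iff (R := S) (M := K) (n := 1)
    exact_mod_cast this.symm
  constructor
  · intro h
    refine le_zero_iff.1 (csSup_le' ?_)
    rintro _ ⟨hlt, K, rfl⟩
    rw [le_zero_iff, ← key, ← le_zero_iff, ← h]
    exact length_le_finLength (ordLength_lt_omega0_iff.1 hlt)
  · intro h
    refine le_zero_iff.1 (finLength_le fun K hK => ((key K).2 (le_zero_iff.1 ?_)).le)
    rw [← h]
    exact le_csSup hbdd ⟨ordLength_lt_omega0_iff.2 hK, K, rfl⟩

end FiniteLength

/-! ### Multiplicities at primes -/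

section Multiplicity

variable {R : Type u} [CommRing R]

/-- The multiplicity of a prime `p` in a module: the supremum of the finite lengths of submodules
of the localization at `p`. -/
noncomputable def multiplicity (M : Type v) [AddCommGroup M] [Module R M] (p : PrimeSpectrum R) :
    ℕ∞ :=
  finLength (Localization.AtPrime p.asIdeal) (LocalizedModule p.asIdeal.primeCompl M)

variable {A B C M : Type v} [AddCommGroup A] [Module R A] [AddCommGroup B] [Module R B]
  [AddCommGroup C] [Module R C] [AddCommGroup M] [Module R M]

theorem multiplicity_le_of_injective {f : A →ₗ[R] B} (hf : Function.Injective f)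
    (p : PrimeSpectrum R) : multiplicity A p ≤ multiplicity B p :=
  finLength_le_of_injective (LocalizedModule.map_injective p.asIdeal.primeCompl f hf)

theorem exact_localizedModule_map (S : Submonoid R) {f : A →ₗ[R] B} {g : B →ₗ[R] C}
    (hfg : Function.Exact f g) :
    Function.Exact (LocalizedModule.map S f) (LocalizedModule.map S g) :=
  LocalizedModule.map_exact S f g hfg

theorem multiplicity_add_length_le {f : A →ₗ[R] B} {g : B →ₗ[R] C} (hf : Function.Injective f)
    (hfg : Function.Exact f g) (hg : Function.Surjective g) {p : PrimeSpectrum R}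
    (hA : Module.length (Localization.AtPrime p.asIdeal)
      (LocalizedModule p.asIdeal.primeCompl A) ≠ ⊤) :
    multiplicity C p + Module.length (Localization.AtPrime p.asIdeal)
      (LocalizedModule p.asIdeal.primeCompl A) ≤ multiplicity B p :=
  finLength_add_length_le (LocalizedModule.map_injective p.asIdeal.primeCompl f hf)
    (exact_localizedModule_map p.asIdeal.primeCompl hfg)
    (LocalizedModule.map_surjective p.asIdeal.primeCompl g hg) hA

theorem multiplicity_ne_top [IsNoetherianRing R] [Module.Finite R M] (p : PrimeSpectrum R) :
    multiplicity M p ≠ ⊤ := by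
  have : IsNoetherianRing (Localization.AtPrime p.asIdeal) :=
    IsLocalization.isNoetherianRing p.asIdeal.primeCompl _ inferInstance
  exact finLength_ne_top

theorem multiplicity_ne_zero_iff [IsNoetherianRing R] {p : PrimeSpectrum R} :
    multiplicity M p ≠ 0 ↔ p.asIdeal ∈ associatedPrimes R M := by
  have : IsNoetherianRing (Localization.AtPrime p.asIdeal) :=
    IsLocalization.isNoetherianRing p.asIdeal.primeCompl _ inferInstance
  rw [multiplicity, finLength_ne_zero_iff,
    ← Module.associatedPrimes.preimage_comap_associatedPrimes_eq_associatedPrimes_of_isLocalizedModule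
      p.asIdeal.primeCompl (Localization.AtPrime p.asIdeal)
      (LocalizedModule.mkLinearMap p.asIdeal.primeCompl M), Set.mem_preimage]
  exact iff_of_eq (congrArg (· ∈ associatedPrimes R M)
    Localization.AtPrime.under_maximalIdeal)

theorem isBinary_iff [IsNoetherianRing R] [Module.Finite R M] :
    IsBinary R M ↔ ∀ p : PrimeSpectrum R, multiplicity M p ≤ 1 := by
  classical
  constructor
  · rintro ⟨S, hS⟩ p
    refine finLength_le_one_iff.2 ?_
    have h : finitisticLength _ _ = _ := hS p
    rw [h]
    split_ifs <;> simp
  · intro h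
    have hfin : {p : PrimeSpectrum R | p.asIdeal ∈ associatedPrimes R M}.Finite :=
      (associatedPrimes.finite R M).preimage fun p _ q _ hpq => PrimeSpectrum.ext hpq
    -- The cycle is supported exactly on the associated primes, which are finite in number.
    refine ⟨hfin.toFinset, fun p => ?_⟩
    have h1 : fundamentalCycle R M p ≤ 1 := finLength_le_one_iff.1 (h p)
    have h0 : fundamentalCycle R M p = 0 ↔ p.asIdeal ∉ associatedPrimes R M := by
      rw [← multiplicity_ne_zero_iff, not_not]
      exact finLength_eq_zero_iff.symm
    split_ifs with hp
    · rw [Set.Finite.mem_toFinset, Set.mem_ofPred_eq] at hp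
      exact le_antisymm h1 (Order.one_le_iff_ne_zero.2 fun h => h0.1 h hp)
    · rw [Set.Finite.mem_toFinset, Set.mem_ofPred_eq] at hp
      exact h0.2 hp

/-- The localization at `q` is cyclic and killed by the maximal ideal, hence a quotient of the
residue field. -/
theorem length_localizedModule_quotient_ne_top {q : PrimeSpectrum R} (e : A ≃ₗ[R] R ⧸ q.asIdeal) :
    Module.length (Localization.AtPrime q.asIdeal)
      (LocalizedModule q.asIdeal.primeCompl A) ≠ ⊤ := by
  set S := Localization.AtPrime q.asIdeal
  let a : A := e.symm 1
  have ha : ∀ b : A, ∃ r : R, b = r • a := fun b => by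
    obtain ⟨r, hr⟩ := Ideal.Quotient.mk_surjective (e b)
    refine ⟨r, e.injective ?_⟩
    rw [map_smul, LinearEquiv.apply_symm_apply, ← hr, Algebra.smul_def, mul_one]
    rfl
  have hqa : ∀ r ∈ q.asIdeal, r • a = 0 := fun r hr => e.injective <| by
    rw [map_smul, LinearEquiv.apply_symm_apply, map_zero, ← Ideal.Quotient.eq_zero_iff_mem.2 hr]
    rw [Algebra.smul_def, mul_one]
    rfl
  let φ : S →ₗ[S] LocalizedModule q.asIdeal.primeCompl A :=
    LinearMap.toSpanSingleton S _ (LocalizedModule.mk a 1)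
  have hφ : Function.Surjective φ := by
    intro y
    induction y using LocalizedModule.induction_on with
    | h m s =>
      obtain ⟨r, rfl⟩ := ha m
      refine ⟨Localization.mk r s, ?_⟩
      rw [LinearMap.toSpanSingleton_apply, LocalizedModule.mk_smul_mk, mul_one]
  have hker : IsLocalRing.maximalIdeal S ≤ LinearMap.ker φ := by
    intro x hx
    induction x using Localization.induction_on with
    | H y =>
      obtain ⟨r, s⟩ := y
      have hr : r ∈ q.asIdeal := by
        rw [Localization.mk_eq_mk'] at hx
        exact (IsLocalization.AtPrime.mk'_mem_maximal_iff S q.asIdeal r s).1 hx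
      rw [LinearMap.mem_ker, LinearMap.toSpanSingleton_apply, LocalizedModule.mk_smul_mk,
        hqa r hr, LocalizedModule.zero_mk]
  have hs : IsSimpleModule S (S ⧸ IsLocalRing.maximalIdeal S) :=
    isSimpleModule_iff_quot_maximal.2 ⟨_, inferInstance, ⟨LinearEquiv.refl _ _⟩⟩
  refine ne_top_of_le_ne_top (b := 1) (by simp) ?_
  rw [← Module.length_eq_one S (S ⧸ IsLocalRing.maximalIdeal S)]
  refine Module.length_le_of_surjective (Submodule.liftQ _ φ hker) ?_
  intro y
  obtain ⟨x, rfl⟩ := hφ y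
  exact ⟨Submodule.Quotient.mk x, rfl⟩

/-- A finite module has finite length at the primes that contain no smaller prime of its support. -/
theorem length_localizedModule_ne_top [IsNoetherianRing R] [hfin : Module.Finite R A]
    {q : PrimeSpectrum R} (hq : ∀ p ∈ Module.support R A, p ≤ q → p = q) :
    Module.length (Localization.AtPrime q.asIdeal)
      (LocalizedModule q.asIdeal.primeCompl A) ≠ ⊤ := by
  -- Dévissage along a prime filtration: the condition on `q` passes to submodules and quotients,
  -- whose supports are smaller, and a factor `R ⧸ p` with `p ≠ q` vanishes at `q`.
  induction hfin using IsNoetherianRing.induction_on_isQuotientEquivQuotientPrime R with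
  | subsingleton N =>
    have : Subsingleton (LocalizedModule q.asIdeal.primeCompl N) :=
      Module.notMem_support_iff.1 (by simp [Module.support_eq_empty])
    rw [Module.length_eq_zero]
    exact ENat.zero_ne_top
  | quotient N p e =>
    have hsupp : ∀ r : PrimeSpectrum R, r ∈ Module.support R N ↔ p ≤ r := fun r => by
      rw [e.support_eq, Module.support_of_algebra, PrimeSpectrum.mem_zeroLocus,
        Ideal.Quotient.algebraMap_eq, Ideal.mk_ker]
      rfl
    by_cases hpq : p ≤ q
    · obtain rfl := hq p ((hsupp p).2 le_rfl) hpq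
      exact length_localizedModule_quotient_ne_top e
    · have : Subsingleton (LocalizedModule q.asIdeal.primeCompl N) :=
        Module.notMem_support_iff.1 fun h => hpq ((hsupp q).1 h)
      rw [Module.length_eq_zero]
      exact ENat.zero_ne_top
  | exact N₁ N₂ N₃ f g hf hg hfg h₁ h₃ =>
    rw [Module.length_eq_add_of_exact _ _
      (LocalizedModule.map_injective q.asIdeal.primeCompl f hf)
      (LocalizedModule.map_surjective q.asIdeal.primeCompl g hg)
      (exact_localizedModule_map q.asIdeal.primeCompl hfg)]
    exact WithTop.add_ne_top.2
      ⟨h₁ fun p hp => hq p (Module.support_subset_of_injective f hf hp),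
        h₃ fun p hp => hq p (Module.support_subset_of_surjective g hg hp)⟩

end Multiplicity

/-! ### Dimensions of primes -/

section PrimeDim

variable {R : Type u} [CommRing R]

/-- The dimension of `R ⧸ p`, as a natural number. -/
noncomputable def primeDim (p : PrimeSpectrum R) : ℕ :=
  (Order.coheight p).toNat

theorem coheight_eq_primeDim (hR : ringKrullDim R < ⊤) (p : PrimeSpectrum R) :
    Order.coheight p = primeDim p := by
  refine (ENat.natCast_toNat fun h => ?_).symm
  have := (Order.coheight_le_krullDim p).trans_lt hR
  rw [h] at this
  exact lt_irrefl _ this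

theorem ringKrullDim_quotient_eq_coheight (p : PrimeSpectrum R) :
    ringKrullDim (R ⧸ p.asIdeal) = Order.coheight p := by
  rw [ringKrullDim_quotient, Order.coheight_eq_krullDim_Ici]
  rfl

theorem ringKrullDim_quotient_eq_primeDim (hR : ringKrullDim R < ⊤) (p : PrimeSpectrum R) :
    ringKrullDim (R ⧸ p.asIdeal) = (primeDim p : WithBot ℕ∞) := by
  rw [ringKrullDim_quotient_eq_coheight, coheight_eq_primeDim hR]
  rfl

theorem primeDim_lt_primeDim (hR : ringKrullDim R < ⊤) {p q : PrimeSpectrum R} (h : p < q) :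
    primeDim q < primeDim p := by
  have h1 := Order.coheight_strictAnti h (by rw [coheight_eq_primeDim hR]; exact ENat.natCast_lt_top _)
  rw [coheight_eq_primeDim hR, coheight_eq_primeDim hR] at h1
  exact_mod_cast h1

theorem primeDim_anti (hR : ringKrullDim R < ⊤) {p q : PrimeSpectrum R} (h : p ≤ q) :
    primeDim q ≤ primeDim p := by
  rcases h.eq_or_lt with rfl | h
  · rfl
  · exact (primeDim_lt_primeDim hR h).le

/-- A common cutoff `D` allows all lengths to be written as `lexSum _ D`. -/
theorem exists_primeDim_lt (hR : ringKrullDim R < ⊤) (e : ℕ) :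
    ∃ D, e < D ∧ ∀ p : PrimeSpectrum R, primeDim p < D := by
  obtain ⟨n, hn⟩ : ∃ n : ℕ, ringKrullDim R ≤ (n : WithBot ℕ∞) := by
    cases h : ringKrullDim R with
    | bot => exact ⟨0, bot_le⟩
    | coe a =>
      have : a ≠ ⊤ := by
        rintro rfl
        rw [h] at hR
        exact lt_irrefl _ hR
      obtain ⟨n, rfl⟩ := ENat.ne_top_iff_exists.1 this
      exact ⟨n, le_rfl⟩
  refine ⟨max e n + 1, by omega, fun p => ?_⟩
  have := (Order.coheight_le_krullDim p).trans hn
  rw [coheight_eq_primeDim hR] at this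
  have : primeDim p ≤ n := by exact_mod_cast this
  omega

end PrimeDim

/-! ### The lower bound for the length -/

section AssociatedPrimes

variable {R : Type u} [CommRing R] [IsNoetherianRing R] {M : Type v} [AddCommGroup M] [Module R M]

theorem mem_support_of_mem_associatedPrimes {p : PrimeSpectrum R}
    (hp : p.asIdeal ∈ associatedPrimes R M) : p ∈ Module.support R M := by
  obtain ⟨-, x, hx⟩ := isAssociatedPrime_iff.1 hp
  refine Module.mem_support_iff'.2 ⟨x, fun r hr h => hr ?_⟩
  rw [hx, Submodule.mem_colon_singleton]
  exact h

/-- For `p ∈ T` of least dimension, embed `R ⧸ p` as `N`. Its only associated prime is `p`, so the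
rest of `T` stays associated to `M ⧸ N`. The chain of `N` comes last, and minimality of `p` prevents
absorption. A subset `T` is used because `M ⧸ N` may acquire new associated primes. -/
theorem hasChain_of_subset_associatedPrimes (hR : ringKrullDim R < ⊤) {D : ℕ}
    (hD : ∀ p : PrimeSpectrum R, primeDim p < D) (T : Finset (PrimeSpectrum R))
    (hT : ∀ p ∈ T, p.asIdeal ∈ associatedPrimes R M) :
    HasChain (Submodule R M) (lexSum.{v} (fun d => (T.filter (primeDim · = d)).card) D) := by
  classical
  induction h : T.card generalizing T M with
  | zero =>
    rw [Finset.card_eq_zero] at h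
    subst h
    rw [lexSum_eq_zero (by simp)]
    exact hasChain_zero _
  | succ n ih =>
    obtain ⟨p, hpT, hmin⟩ := T.exists_min_image primeDim (Finset.card_pos.1 (by omega))
    obtain ⟨-, f, hf⟩ := (isAssociatedPrime_iff_exists_injective_linearMap _ _).1 (hT p hpT)
    let N := LinearMap.range f
    let e : (R ⧸ p.asIdeal) ≃ₗ[R] N := LinearEquiv.ofInjective f hf
    have hN : HasChain (Submodule R N) (ω ^ (primeDim p : Ordinal.{v})) :=
      (hasChain_quotient_prime _ p (coheight_eq_primeDim hR p).ge).map
        (Submodule.map_strictMono_of_injective (f := e.toLinearMap) e.injective)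
    have hQ := ih (M := M ⧸ N) (T.erase p) (fun q hq => by
      obtain ⟨hqp, hqT⟩ := Finset.mem_erase.1 hq
      refine (associatedPrimes.subset_union_of_exact N.injective_subtype
        (LinearMap.exact_subtype_mkQ N) (hT q hqT)).resolve_left fun hqN => hqp ?_
      rw [← LinearEquiv.AssociatedPrimes.eq e,
        associatedPrimes.eq_singleton_of_isPrimary p.isPrime.isPrimary, p.isPrime.radical] at hqN
      exact PrimeSpectrum.ext hqN) (by rw [Finset.card_erase_of_mem hpT]; omega)
    refine (hQ.add hN).of_le (lexSum_add_opow (hD p) (fun i hi => ?_) ?_ fun i hi => ?_).le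
    · rw [Finset.card_eq_zero, Finset.filter_eq_empty_iff]
      intro q hq hqi
      have := hmin q (Finset.mem_of_mem_erase hq)
      omega
    · rw [Finset.filter_erase, Finset.card_erase_add_one]
      exact Finset.mem_filter.2 ⟨hpT, rfl⟩
    · rw [Finset.filter_erase, Finset.erase_eq_of_notMem]
      exact fun h => hi (Finset.mem_filter.1 h).2.symm

end AssociatedPrimes

/-! ### The upper bound and the length formula -/

section LengthFormula

variable {R : Type u} [CommRing R] [IsNoetherianRing R]

variable (R) in
/-- The finite set of associated primes of `M` with `dim (R ⧸ p) = d`. -/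
noncomputable def assPrimes (M : Type v) [AddCommGroup M] [Module R M] [Module.Finite R M]
    (d : ℕ) : Finset (PrimeSpectrum R) :=
  Set.Finite.toFinset (s := {p | p.asIdeal ∈ associatedPrimes R M ∧ primeDim p = d})
    (((associatedPrimes.finite R M).preimage fun _ _ _ _ h => PrimeSpectrum.ext h).subset
      fun _ h => h.1)

variable (R) in
/-- The sum of the multiplicities of the primes of dimension `d` in `M`. -/
noncomputable def dimRank (M : Type v) [AddCommGroup M] [Module R M] [Module.Finite R M]
    (d : ℕ) : ℕ :=
  ∑ p ∈ assPrimes R M d, (multiplicity M p).toNat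

variable {A B C M : Type v} [AddCommGroup A] [Module R A] [AddCommGroup B] [Module R B]
  [AddCommGroup C] [Module R C] [AddCommGroup M] [Module R M]
  [Module.Finite R A] [Module.Finite R B] [Module.Finite R C] [Module.Finite R M]

theorem mem_assPrimes {d : ℕ} {p : PrimeSpectrum R} :
    p ∈ assPrimes R M d ↔ p.asIdeal ∈ associatedPrimes R M ∧ primeDim p = d := by
  simp [assPrimes]

theorem numAssPrimes_eq (hR : ringKrullDim R < ⊤) (d : ℕ) :
    numAssPrimes R M d = (assPrimes R M d).card := by
  have : {p : Ideal R | p ∈ associatedPrimes R M ∧ ringKrullDim (R ⧸ p) = (d : WithBot ℕ∞)} =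
      PrimeSpectrum.asIdeal '' (assPrimes R M d : Set (PrimeSpectrum R)) := by
    ext p
    simp only [Set.mem_ofPred_eq, Set.mem_image, Finset.mem_coe, mem_assPrimes]
    constructor
    · rintro ⟨hp, hd⟩
      refine ⟨⟨p, hp.isPrime⟩, ⟨hp, ?_⟩, rfl⟩
      rw [ringKrullDim_quotient_eq_primeDim hR ⟨p, hp.isPrime⟩] at hd
      exact_mod_cast hd
    · rintro ⟨q, ⟨hq, rfl⟩, rfl⟩
      exact ⟨hq, ringKrullDim_quotient_eq_primeDim hR q⟩
  rw [numAssPrimes, this, Set.ncard_image_of_injective _ fun _ _ h => PrimeSpectrum.ext h,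
    Set.ncard_coe_finset]

theorem dimRank_le {d : ℕ}
    (h : ∀ p : PrimeSpectrum R, primeDim p = d → multiplicity C p ≤ multiplicity B p) :
    dimRank R C d ≤ dimRank R B d := by
  have hsub : assPrimes R C d ⊆ assPrimes R B d := fun p hp => by
    rw [mem_assPrimes, ← multiplicity_ne_zero_iff] at hp ⊢
    exact ⟨fun h0 => hp.1 (le_zero_iff.1 (h0 ▸ h p hp.2)), hp.2⟩
  calc dimRank R C d ≤ ∑ p ∈ assPrimes R C d, (multiplicity B p).toNat :=
        Finset.sum_le_sum fun p hp =>
          ENat.toNat_le_toNat (h p (mem_assPrimes.1 hp).2) (multiplicity_ne_top p)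
    _ ≤ dimRank R B d := Finset.sum_le_sum_of_subset hsub

theorem dimRank_lt {d : ℕ}
    (h : ∀ p : PrimeSpectrum R, primeDim p = d → multiplicity C p ≤ multiplicity B p)
    {p : PrimeSpectrum R} (hp : primeDim p = d) (hlt : multiplicity C p < multiplicity B p) :
    dimRank R C d < dimRank R B d := by
  have hsub : assPrimes R C d ⊆ assPrimes R B d := fun p hp => by
    rw [mem_assPrimes, ← multiplicity_ne_zero_iff] at hp ⊢
    exact ⟨fun h0 => hp.1 (le_zero_iff.1 (h0 ▸ h p hp.2)), hp.2⟩
  calc dimRank R C d = ∑ p ∈ assPrimes R B d, (multiplicity C p).toNat := by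
        refine Finset.sum_subset hsub fun q hq hq' => ?_
        have : multiplicity C q = 0 := by
          by_contra h0
          exact hq' (mem_assPrimes.2 ⟨multiplicity_ne_zero_iff.1 h0, (mem_assPrimes.1 hq).2⟩)
        simp [this]
    _ < dimRank R B d := by
        refine Finset.sum_lt_sum (fun q hq =>
          ENat.toNat_le_toNat (h q (mem_assPrimes.1 hq).2) (multiplicity_ne_top q)) ⟨p, ?_, ?_⟩
        · exact mem_assPrimes.2 ⟨multiplicity_ne_zero_iff.1 hlt.ne_bot, hp⟩
        · rwa [← ENat.natCast_lt_natCast, ENat.natCast_toNat (multiplicity_ne_top p),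
            ENat.natCast_toNat (multiplicity_ne_top p)]

theorem exists_associatedPrime_le {p : PrimeSpectrum R} (hp : p ∈ Module.support R M) :
    ∃ q : PrimeSpectrum R, q.asIdeal ∈ associatedPrimes R M ∧ q ≤ p := by
  obtain ⟨q, hq, hqp⟩ := Ideal.exists_minimalPrimes_le (Module.annihilator_le_of_mem_support hp)
  exact ⟨⟨q, hq.1.1⟩,
    Module.associatedPrimes.minimalPrimes_annihilator_subset_associatedPrimes R M hq, hqp⟩

/-- Let `p` be an associated prime of the kernel of maximal dimension. At primes of dimension at
least `dim (R ⧸ p)` the kernel has finite length, so multiplicities cannot grow there; at `p` itself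
they drop. Lower dimensions are irrelevant lexicographically. -/
theorem lexSum_dimRank_lt (hR : ringKrullDim R < ⊤) {D : ℕ}
    (hD : ∀ p : PrimeSpectrum R, primeDim p < D) {g : B →ₗ[R] C} (hg : Function.Surjective g)
    (hg' : ¬ Function.Injective g) :
    lexSum.{v} (dimRank R C) D < lexSum (dimRank R B) D := by
  let A := LinearMap.ker g
  have hA : Nontrivial A := Submodule.nontrivial_iff_ne_bot.2 fun h => hg' (LinearMap.ker_eq_bot.1 h)
  obtain ⟨p, hp, hmax⟩ : ∃ p : PrimeSpectrum R, p.asIdeal ∈ associatedPrimes R A ∧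
      ∀ q : PrimeSpectrum R, q.asIdeal ∈ associatedPrimes R A → primeDim q ≤ primeDim p := by
    have hfin : {p : PrimeSpectrum R | p.asIdeal ∈ associatedPrimes R A}.Finite :=
      (associatedPrimes.finite R A).preimage fun p _ q _ hpq => PrimeSpectrum.ext hpq
    obtain ⟨I, hI⟩ := associatedPrimes.nonempty R A
    exact hfin.exists_maximalFor primeDim _ ⟨⟨I, hI.isPrime⟩, hI⟩ |>.imp fun p hp =>
      ⟨hp.1, fun q hq => (le_total _ _).elim id fun h => hp.2 hq h⟩
  have hlen : ∀ q : PrimeSpectrum R, primeDim p ≤ primeDim q →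
      Module.length (Localization.AtPrime q.asIdeal)
        (LocalizedModule q.asIdeal.primeCompl A) ≠ ⊤ := fun q hq => by
    -- A prime of the support strictly below `q` would lie above an associated prime of dimension
    -- greater than that of `p`.
    refine length_localizedModule_ne_top fun p' hp' hle => ?_
    obtain ⟨p'', hp'', hle'⟩ := exists_associatedPrime_le hp'
    by_contra hne
    have h1 := primeDim_lt_primeDim hR (lt_of_le_of_ne hle hne)
    have h2 := primeDim_anti hR hle'
    have h3 := hmax p'' hp''
    omega
  have hadd : ∀ q : PrimeSpectrum R, primeDim p ≤ primeDim q →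
      multiplicity C q + Module.length (Localization.AtPrime q.asIdeal)
        (LocalizedModule q.asIdeal.primeCompl A) ≤ multiplicity B q := fun q hq =>
    multiplicity_add_length_le A.injective_subtype (LinearMap.exact_subtype_ker_map g) hg
      (hlen q hq)
  have hle : ∀ q : PrimeSpectrum R, primeDim p ≤ primeDim q →
      multiplicity C q ≤ multiplicity B q := fun q hq => le_self_add.trans (hadd q hq)
  refine lexSum_lt_lexSum (hD p) (dimRank_lt (fun q hq => hle q hq.ge) rfl ?_)
    fun i hi => dimRank_le fun q hq => hle q (by omega)
  refine lt_of_lt_of_le ?_ (hadd p le_rfl)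
  have : Nontrivial (LocalizedModule p.asIdeal.primeCompl A) :=
    Module.mem_support_iff.1 (mem_support_of_mem_associatedPrimes hp)
  have hpos : 0 < Module.length (Localization.AtPrime p.asIdeal)
      (LocalizedModule p.asIdeal.primeCompl A) := Module.length_pos
  rw [add_comm]
  exact ENat.lt_add_left (multiplicity_ne_top p) hpos

theorem ordLength_le_lexSum_dimRank (hR : ringKrullDim R < ⊤) {D : ℕ}
    (hD : ∀ p : PrimeSpectrum R, primeDim p < D) :
    ordLength R M ≤ lexSum.{v} (dimRank R M) D := by
  let G : Submodule R M → Ordinal.{v} := fun N => lexSum (dimRank R (M ⧸ N)) D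
  have hG : ∀ {N N' : Submodule R M}, N < N' → G N' < G N := fun {N N'} h => by
    refine lexSum_dimRank_lt hR hD (Submodule.factor_surjective h.le) fun hinj => h.not_ge ?_
    intro x hx
    have h0 : Submodule.factor h.le (N.mkQ x) = Submodule.factor h.le 0 := by
      simpa using hx
    simpa using hinj h0
  refine ordLength_le fun α ⟨N, hN⟩ => ?_
  -- A strictly increasing function on ordinals satisfies `i ≤ f i`; here `f i = G (N i)`.
  have key : ∀ i, i ≤ α → i ≤ G (N i) := by
    intro i
    induction i using WellFoundedLT.induction with
    | ind i ih =>
      intro hi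
      by_contra! hlt
      have h1 := ih _ hlt (hlt.le.trans hi)
      exact (hG (hN (Set.mem_Iic.2 (hlt.le.trans hi)) (Set.mem_Iic.2 hi) hlt)).not_ge h1
  refine (key α le_rfl).trans ?_
  by_cases h : Function.Injective (N α).mkQ
  · refine (lexSum_congr fun d _ => le_antisymm ?_ ?_).le
    · let e := LinearEquiv.ofBijective _ ⟨h, (N α).mkQ_surjective⟩
      exact dimRank_le fun p _ => multiplicity_le_of_injective (f := e.symm.toLinearMap)
        e.symm.injective p
    · exact dimRank_le fun p _ => multiplicity_le_of_injective h p
  · exact (lexSum_dimRank_lt hR hD (N α).mkQ_surjective h).le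

/-- The length of a binary module is `∑ ω ^ dim (R ⧸ p)`, in decreasing order, where `p` runs over
the associated primes. -/
theorem IsBinary.ordLength_eq (hM : IsBinary R M) (hR : ringKrullDim R < ⊤) {D : ℕ}
    (hD : ∀ p : PrimeSpectrum R, primeDim p < D) :
    ordLength R M = lexSum.{v} (numAssPrimes R M) D := by
  classical
  refine le_antisymm ((ordLength_le_lexSum_dimRank hR hD).trans (lexSum_congr fun d _ => ?_).le) ?_
  -- Binarity makes every multiplicity at an associated prime equal to 1, so `dimRank` counts these
  -- primes.
  · rw [numAssPrimes_eq hR, Finset.card_eq_sum_ones]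
    refine Finset.sum_congr rfl fun p hp => ?_
    have h0 := multiplicity_ne_zero_iff.2 (mem_assPrimes.1 hp).1
    rw [le_antisymm (isBinary_iff.1 hM p) (Order.one_le_iff_ne_zero.2 h0)]
    rfl
  · refine HasChain.le_ordLength ?_
    refine (hasChain_of_subset_associatedPrimes hR hD
      ((Finset.range D).biUnion (assPrimes R M)) fun p hp => ?_).of_le
      (lexSum_congr fun d hd => ?_).le
    · obtain ⟨d, -, hp⟩ := Finset.mem_biUnion.1 hp
      exact (mem_assPrimes.1 hp).1
    · rw [numAssPrimes_eq hR]
      congr 1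
      ext p
      simp only [Finset.mem_filter, Finset.mem_biUnion, Finset.mem_range, mem_assPrimes]
      constructor
      · rintro ⟨hp, rfl⟩
        exact ⟨⟨_, hd, hp, rfl⟩, rfl⟩
      · rintro ⟨⟨_, -, hp, -⟩, rfl⟩
        exact ⟨hp, rfl⟩

end LengthFormula

/-! ### The dimension filtration -/

section DimFiltration

variable {R : Type u} [CommRing R] {M : Type v} [AddCommGroup M] [Module R M]

theorem elemDim_le_iff (hR : ringKrullDim R < ⊤) {a : M} {n : ℕ} :
    elemDim R a ≤ (n : WithBot ℕ∞) ↔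
      ∀ p ∈ Module.support R (Submodule.span R {a}), primeDim p ≤ n := by
  constructor
  · intro h p hp
    have h1 : (Order.coheight p : WithBot ℕ∞) ≤ elemDim R a := by
      rw [Order.coheight_eq_krullDim_Ici]
      exact Order.krullDim_le_of_strictMono
        (fun q : Set.Ici p => (⟨q.1, Module.mem_support_mono q.2 hp⟩ :
          Module.support R (Submodule.span R {a}))) fun _ _ hlt => hlt
    have := h1.trans h
    rw [coheight_eq_primeDim hR] at this
    exact_mod_cast this
  · intro h
    refine iSup_le fun s => ?_
    have h1 : (s.length : ℕ∞) ≤ Order.coheight s.head.1 :=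
      Order.length_le_coheight (p := s.map Subtype.val fun _ _ hlt => hlt) le_rfl
    rw [coheight_eq_primeDim hR] at h1
    have h2 : s.length ≤ primeDim s.head.1 := by exact_mod_cast h1
    exact_mod_cast h2.trans (h _ s.head.2)

theorem mem_dimFiltration_iff (hR : ringKrullDim R < ⊤) {a : M} {e : ℤ} :
    a ∈ dimFiltration R M e ↔
      ∀ p : PrimeSpectrum R, (∀ r ∉ p.asIdeal, r • a ≠ 0) → (primeDim p : ℤ) ≤ e := by
  simp_rw [← mem_support_span_singleton]
  constructor
  · rintro (rfl | ⟨n, hn, ha⟩) p hp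
    · exact absurd (smul_zero 1) ((mem_support_span_singleton _ _).1 hp 1
        ((Ideal.ne_top_iff_one _).1 p.isPrime.ne_top))
    · exact le_trans (by exact_mod_cast (elemDim_le_iff hR).1 ha p hp) hn
  · intro h
    by_cases ha : a = 0
    · exact Or.inl ha
    · have : Nontrivial (Submodule.span R {a}) :=
        Submodule.nontrivial_iff_ne_bot.2 (by simpa using ha)
      obtain ⟨p, hp⟩ := Module.nonempty_support_of_nontrivial (R := R) (M := Submodule.span R {a})
      have hp' := h p hp
      -- A prime in the support forces `e ≥ 0`, so `e.toNat` is `e`.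
      exact Or.inr ⟨e.toNat, by omega, (elemDim_le_iff hR).2 fun q hq => by have := h q hq; omega⟩

/-- The dimension of an element is intrinsic. For `N = D_e(M)` this makes `D_e(M) ⧸ D_{e-1}(M)` the
quotient of `N` by a step of its own filtration. -/
theorem submoduleOf_dimFiltration (hR : ringKrullDim R < ⊤) (N : Submodule R M) (e : ℤ) :
    (dimFiltration R M e).submoduleOf N = dimFiltration R N e := by
  ext x
  rw [Submodule.submoduleOf, Submodule.mem_comap, mem_dimFiltration_iff hR,
    mem_dimFiltration_iff hR]
  simp only [Submodule.subtype_apply, ne_eq, Subtype.ext_iff, Submodule.coe_smul,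
    ZeroMemClass.coe_zero]

theorem primeDim_le_of_mem_support_dimFiltration (hR : ringKrullDim R < ⊤) {e : ℤ}
    {p : PrimeSpectrum R} (hp : p ∈ Module.support R (dimFiltration R M e)) :
    (primeDim p : ℤ) ≤ e := by
  obtain ⟨x, hx⟩ := Module.mem_support_iff'.1 hp
  exact (mem_dimFiltration_iff hR).1 x.2 p fun r hr h => hx r hr (Subtype.ext h)

variable [IsNoetherianRing R]

/-- If `x` has annihilator `p`, the support of `R x` consists of primes above `p`, so `x` lies in
`D_e(M)` once `dim (R ⧸ p) ≤ e`. -/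
theorem mem_associatedPrimes_dimFiltration_iff (hR : ringKrullDim R < ⊤) {e : ℤ}
    {p : PrimeSpectrum R} :
    p.asIdeal ∈ associatedPrimes R (dimFiltration R M e) ↔
      p.asIdeal ∈ associatedPrimes R M ∧ (primeDim p : ℤ) ≤ e := by
  constructor
  · exact fun h => ⟨associatedPrimes.subset_of_injective (dimFiltration R M e).injective_subtype h,
      primeDim_le_of_mem_support_dimFiltration hR (mem_support_of_mem_associatedPrimes h)⟩
  · rintro ⟨h, hpe⟩
    obtain ⟨hpr, x, hx⟩ := isAssociatedPrime_iff.1 h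
    have hxD : x ∈ dimFiltration R M e := by
      refine (mem_dimFiltration_iff hR).2 fun q hq => ?_
      have hpq : p ≤ q := fun r hr => by
        by_contra hrq
        refine hq r hrq ?_
        rw [hx, Submodule.mem_colon_singleton] at hr
        exact hr
      have := primeDim_anti hR hpq
      omega
    refine isAssociatedPrime_iff.2 ⟨hpr, ⟨x, hxD⟩, ?_⟩
    rw [hx]
    ext r
    simp [Submodule.mem_colon_singleton, Subtype.ext_iff]

/-- Suppose `p` annihilates the class of `a` and has dimension at most `e`. A prime `q` in the
support of `R a` either contains `p`, or lies in the support of `R (r • a)` for some `r ∈ p` outside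
`q`, where `r • a ∈ D_e(M)`. Either way `dim (R ⧸ q) ≤ e`, so `a ∈ D_e(M)`. -/
theorem lt_primeDim_of_mem_associatedPrimes_quotient (hR : ringKrullDim R < ⊤) {e : ℤ}
    {p : PrimeSpectrum R} (hp : p.asIdeal ∈ associatedPrimes R (M ⧸ dimFiltration R M e)) :
    e < (primeDim p : ℤ) := by
  by_contra! hpe
  obtain ⟨hpr, y, hy⟩ := isAssociatedPrime_iff.1 hp
  obtain ⟨a, rfl⟩ := Submodule.Quotient.mk_surjective _ y
  have hmem : ∀ r, r ∈ p.asIdeal ↔ r • a ∈ dimFiltration R M e := fun r => by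
    rw [hy, Submodule.mem_colon_singleton, ← Submodule.Quotient.mk_smul, Submodule.mem_bot,
      Submodule.Quotient.mk_eq_zero]
  refine hpr.one_notMem ((hmem 1).2 ?_)
  rw [one_smul, mem_dimFiltration_iff hR]
  intro q hq
  by_cases hpq : p ≤ q
  · have := primeDim_anti hR hpq
    omega
  · obtain ⟨r, hrp, hrq⟩ := Set.not_subset.1 hpq
    refine (mem_dimFiltration_iff hR).1 ((hmem r).1 hrp) q fun t ht => ?_
    rw [← mul_smul]
    exact hq _ fun h => (q.isPrime.mem_or_mem h).elim ht hrq

/-- In dimension at most `e` the quotient has multiplicity zero; above `e` the submodule `D_e(M)`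
localizes to zero. -/
theorem multiplicity_quotient_dimFiltration_le (hR : ringKrullDim R < ⊤) (e : ℤ)
    (p : PrimeSpectrum R) :
    multiplicity (M ⧸ dimFiltration R M e) p ≤ multiplicity M p := by
  by_cases hp : (primeDim p : ℤ) ≤ e
  · have : multiplicity (M ⧸ dimFiltration R M e) p = 0 := by
      by_contra h0
      exact hp.not_gt
        (lt_primeDim_of_mem_associatedPrimes_quotient hR (multiplicity_ne_zero_iff.1 h0))
    simp [this]
  · have : Subsingleton (LocalizedModule p.asIdeal.primeCompl (dimFiltration R M e)) :=
      Module.notMem_support_iff.1 fun h => hp (primeDim_le_of_mem_support_dimFiltration hR h)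
    refine le_self_add.trans (multiplicity_add_length_le
      (dimFiltration R M e).injective_subtype (LinearMap.exact_subtype_mkQ _)
      (Submodule.mkQ_surjective _) ?_)
    rw [Module.length_eq_zero]
    exact ENat.zero_ne_top

theorem mem_associatedPrimes_quotient_dimFiltration_iff (hR : ringKrullDim R < ⊤) {e : ℤ}
    {p : PrimeSpectrum R} :
    p.asIdeal ∈ associatedPrimes R (M ⧸ dimFiltration R M e) ↔
      p.asIdeal ∈ associatedPrimes R M ∧ e < (primeDim p : ℤ) := by
  constructor
  · intro h
    refine ⟨multiplicity_ne_zero_iff.1 fun h0 => multiplicity_ne_zero_iff.2 h ?_,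
      lt_primeDim_of_mem_associatedPrimes_quotient hR h⟩
    exact le_zero_iff.1 (h0 ▸ multiplicity_quotient_dimFiltration_le hR e p)
  · rintro ⟨h, hpe⟩
    refine (associatedPrimes.subset_union_of_exact (dimFiltration R M e).injective_subtype
      (LinearMap.exact_subtype_mkQ _) h).resolve_left fun h' => ?_
    exact ((mem_associatedPrimes_dimFiltration_iff hR).1 h').2.not_gt hpe

variable [Module.Finite R M]

theorem numAssPrimes_dimFiltration (hR : ringKrullDim R < ⊤) (e : ℤ) (d : ℕ) :
    numAssPrimes R (dimFiltration R M e) d = if (d : ℤ) ≤ e then numAssPrimes R M d else 0 := by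
  rw [numAssPrimes_eq hR, numAssPrimes_eq hR]
  split_ifs with h
  · congr 1
    ext p
    rw [mem_assPrimes, mem_assPrimes, mem_associatedPrimes_dimFiltration_iff hR]
    grind
  · rw [Finset.card_eq_zero, Finset.eq_empty_iff_forall_notMem]
    intro p hp
    rw [mem_assPrimes, mem_associatedPrimes_dimFiltration_iff hR] at hp
    grind

theorem numAssPrimes_quotient_dimFiltration (hR : ringKrullDim R < ⊤) (e : ℤ) (d : ℕ) :
    numAssPrimes R (M ⧸ dimFiltration R M e) d =
      if e < (d : ℤ) then numAssPrimes R M d else 0 := by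
  rw [numAssPrimes_eq hR, numAssPrimes_eq hR]
  split_ifs with h
  · congr 1
    ext p
    rw [mem_assPrimes, mem_assPrimes, mem_associatedPrimes_quotient_dimFiltration_iff hR]
    grind
  · rw [Finset.card_eq_zero, Finset.eq_empty_iff_forall_notMem]
    intro p hp
    rw [mem_assPrimes, mem_associatedPrimes_quotient_dimFiltration_iff hR] at hp
    grind

theorem IsBinary.dimFiltration (hM : IsBinary R M) (e : ℤ) :
    IsBinary R (dimFiltration R M e) :=
  isBinary_iff.2 fun p => (multiplicity_le_of_injective
    (OrdinalLength.dimFiltration R M e).injective_subtype p).trans (isBinary_iff.1 hM p)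

theorem IsBinary.quotient_dimFiltration (hM : IsBinary R M) (hR : ringKrullDim R < ⊤) (e : ℤ) :
    IsBinary R (M ⧸ OrdinalLength.dimFiltration R M e) :=
  isBinary_iff.2 fun p =>
    (multiplicity_quotient_dimFiltration_le hR e p).trans (isBinary_iff.1 hM p)

end DimFiltration

end OrdinalLength

/-! ### Lengths of the pieces of the filtration -/

theorem propositionP {R : Type u} {M : Type v} [CommRing R] [IsNoetherianRing R]
    (hR : ringKrullDim R < ⊤) [AddCommGroup M] [Module R M] [Module.Finite R M]
    (hM : OrdinalLength.IsBinary R M) (μ : Ordinal.{v}) (hμ : OrdinalLength.ordLength R M = μ)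
    (e : ℕ) (he : (e : WithBot ℕ∞) ≤ Module.supportDim R M) :
    (OrdinalLength.IsBinary R (OrdinalLength.dimFiltration R M e) ∧
      OrdinalLength.ordLength R (OrdinalLength.dimFiltration R M e) =
        OrdinalLength.lowerPart μ e) ∧
    (OrdinalLength.IsBinary R (M ⧸ OrdinalLength.dimFiltration R M e) ∧
      OrdinalLength.ordLength R (M ⧸ OrdinalLength.dimFiltration R M e) =
        OrdinalLength.upperPart μ e) ∧
    (OrdinalLength.IsBinary R
        (OrdinalLength.dimFiltration R M e ⧸
          (OrdinalLength.dimFiltration R M ((e : ℤ) - 1)).submoduleOf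
            (OrdinalLength.dimFiltration R M e)) ∧
      OrdinalLength.ordLength R
        (OrdinalLength.dimFiltration R M e ⧸
          (OrdinalLength.dimFiltration R M ((e : ℤ) - 1)).submoduleOf
            (OrdinalLength.dimFiltration R M e)) =
        ω ^ (e : Ordinal.{v}) * (OrdinalLength.numAssPrimes R M e : Ordinal.{v})) := by
  obtain ⟨D, heD, hD⟩ := OrdinalLength.exists_primeDim_lt hR e
  subst hμ
  have hE := hM.dimFiltration e
  have hQ := hM.quotient_dimFiltration hR e
  have hG := hE.quotient_dimFiltration hR ((e : ℤ) - 1)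
  rw [OrdinalLength.submoduleOf_dimFiltration hR]
  refine ⟨⟨hE, ?_⟩, ⟨hQ, ?_⟩, hG, ?_⟩
  · rw [hE.ordLength_eq hR hD, hM.ordLength_eq hR hD, OrdinalLength.lowerPart_lexSum]
    refine OrdinalLength.lexSum_congr fun d _ => ?_
    simp [OrdinalLength.numAssPrimes_dimFiltration hR]
  · rw [hQ.ordLength_eq hR hD, hM.ordLength_eq hR hD, OrdinalLength.upperPart_lexSum]
    refine OrdinalLength.lexSum_congr fun d _ => ?_
    simp [OrdinalLength.numAssPrimes_quotient_dimFiltration hR]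
  -- The conditions `d ≤ e` and `e - 1 < d` leave only `d = e`.
  · have hnum : ∀ d, OrdinalLength.numAssPrimes R (OrdinalLength.dimFiltration R M e ⧸
        OrdinalLength.dimFiltration R (OrdinalLength.dimFiltration R M e) ((e : ℤ) - 1)) d =
        if d = e then OrdinalLength.numAssPrimes R M d else 0 := fun d => by
      rw [OrdinalLength.numAssPrimes_quotient_dimFiltration hR,
        OrdinalLength.numAssPrimes_dimFiltration hR]
      split_ifs <;> first | rfl | omega
    rw [hG.ordLength_eq hR hD, OrdinalLength.lexSum_single heD fun i hi => by simp [hnum, hi],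
      hnum, if_pos rfl]
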